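/- Let $r\ge 8$ and let $\Omega\subset\mathbb R^2$ be a bounded strictly convex domain whose boundary is a closed $C^r$ curve of length $L=|\partial\Omega|$ with nowhere vanishing curvature. Let $s$ be arclength on $\partial\Omega$ (measured from a fixed point and lifted to $\mathbb R$), let $\rho(s)$ be the radius of curvature, and put $$C_\Omega=\Big(\int_0^{L}\rho^{-2/3}(s)\,ds\Big)^{-1},\qquad x(s)=C_\Omega\int_0^s\rho^{-2/3}(\tau)\,d\tau .$$ The map $s\mapsto x(s)$ is a bijection of $\mathbb R$ with inverse $s(x)$; $x$ is the Lazutkin parameter. Write $\rho(x)=\rho(s(x))$, $\rho'(x)=\frac{d\rho}{ds}(s(x))$, $\rho''(x)=\frac{d^2\rho}{ds^2}(s(x))$ (derivatives of $\rho$ with respect to arclength, evaluated at the point with Lazutkin parameter $x$), and $\mu(x)=\dfrac{1}{2C_\Omega\,\rho(x)^{1/3}}$. Let $\alpha,\beta:\mathbb R\to\mathbb R$ be $1$-periodic functions of class $C^{r-4}$ that are the coefficients of the Lazutkin expansion of the periodic billiard orbits of rotation number $1/q$, in the following sense: there is a constant $C$ such that for every $q\ge2$ and every periodic billiard orbit in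 $\Omega$ of rotation number $1/q$, with collision points of (lifted) Lazutkin parameters $x_k$ and angles $\varphi_k$ between the trajectory and the tangent at the collisions ($k\in\mathbb Z$, $x_{k+q}=x_k+1$), there are a phase $\theta\in\mathbb R$ and numbers $a_k,b_k$ with $|a_k|,|b_k|\le C$ such that for all $k$ $$x_k=\theta+\frac kq+\frac{\alpha(\theta+\frac kq)}{q^2}+\frac{a_k}{q^4},\qquad \varphi_k=\frac{\mu(x_k)}{q}\Big(1+\frac{\beta(\theta+\frac kq)}{q^2}+\frac{b_k}{q^4}\Big).$$ Then for every $x\in\mathbb R$ (with $\alpha'=d\alpha/dx$) $$\alpha'(x)=\beta(x)-\frac{\rho^{1/3}(x)\,\rho''(x)}{36\,C_\Omega^2}+\frac{\rho^{-2/3}(x)\,(\rho'(x))^2}{54\,C_\Omega^2}.$$ -/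

import Mathlib

open Set Filter MeasureTheory

noncomputable section

/-- The Euclidean plane. -/
abbrev Plane : Type := EuclideanSpace ℝ (Fin 2)

/-- `Ω` is a strictly convex planar domain whose boundary is a closed `C^r` curve of length `L`
with nowhere vanishing curvature, and `γ` is the arclength parametrization of the boundary,
extended `L`-periodically to the line. (For an open convex set whose boundary is such a curve,
`curvature_ne` is what makes the radius of curvature finite, and it implies that the boundary
contains no segment.) -/
structure IsConvexBilliardTable (r : ℕ) (Ω : Set Plane) (L : ℝ) (γ : ℝ → Plane) : Prop where
  isOpen : IsOpen Ω
  nonempty : Ω.Nonempty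
  bounded : Bornology.IsBounded Ω
  convex : Convex ℝ Ω
  length_pos : 0 < L
  contDiff : ContDiff ℝ r γ
  unit_speed : ∀ s, ‖deriv γ s‖ = 1
  periodic : Function.Periodic γ L
  injOn : InjOn γ (Ico 0 L)
  range_eq : range γ = frontier Ω
  curvature_ne : ∀ s, deriv (deriv γ) s ≠ 0

/-- Radius of curvature `ρ(s)` of a unit speed curve `γ`, as a function of arclength. -/
def curvRadius (γ : ℝ → Plane) (s : ℝ) : ℝ := ‖deriv (deriv γ) s‖⁻¹

/-- The constant `C_Ω = (∫_{∂Ω} ρ^{-2/3} ds)⁻¹`. -/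
def lazutkinConst (L : ℝ) (γ : ℝ → Plane) : ℝ :=
  (∫ s in (0 : ℝ)..L, curvRadius γ s ^ (-(2 / 3) : ℝ))⁻¹

/-- The Lazutkin parameter `x(s) = C_Ω ∫_0^s ρ^{-2/3} dτ` of the point of arclength `s`. -/
def lazutkinParam (L : ℝ) (γ : ℝ → Plane) (s : ℝ) : ℝ :=
  lazutkinConst L γ * ∫ t in (0 : ℝ)..s, curvRadius γ t ^ (-(2 / 3) : ℝ)

/-- The arclength `s(x)` of the point with Lazutkin parameter `x`: the inverse of
`s ↦ x(s)`, which is a bijection of the line by `lazutkinParam_bijective`. -/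
def arclengthOf (L : ℝ) (γ : ℝ → Plane) : ℝ → ℝ :=
  Function.invFun (lazutkinParam L γ)

/-- The Lazutkin density `μ(x) = 1 / (2 C_Ω ρ(x)^{1/3})`, where `ρ(x)` means `ρ(s(x))`. -/
def lazutkinDensity (L : ℝ) (γ : ℝ → Plane) (x : ℝ) : ℝ :=
  1 / (2 * lazutkinConst L γ * curvRadius γ (arclengthOf L γ x) ^ (1 / 3 : ℝ))

/-- A billiard trajectory. The `k`-th collision is at the boundary point of arclength `s k`
(lifted to the line so that each flight advances by an amount in `(0, L)`), and `φ k` is the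
angle between the positive tangent there and the trajectory. At each collision the angle of the
outgoing chord with the tangent (reflection) equals that of the incoming chord (incidence). -/
structure IsBilliardTrajectory (L : ℝ) (γ : ℝ → Plane) (s φ : ℤ → ℝ) : Prop where
  advance : ∀ k, s k < s (k + 1) ∧ s (k + 1) < s k + L
  outgoing : ∀ k, InnerProductGeometry.angle (deriv γ (s k)) (γ (s (k + 1)) - γ (s k)) = φ k
  incoming : ∀ k, InnerProductGeometry.angle (deriv γ (s k)) (γ (s k) - γ (s (k - 1))) = φ k

/-- A periodic billiard trajectory of rotation number `1/q`: it closes up after `q` collisions,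
having gone around the boundary exactly once. -/
structure IsPeriodicOrbitOneOver (q : ℕ) (L : ℝ) (γ : ℝ → Plane) (s φ : ℤ → ℝ) : Prop
    extends IsBilliardTrajectory L γ s φ where
  closes : ∀ k, s (k + q) = s k + L

/-- `α` and `β` are coefficient functions of the Lazutkin expansion of the periodic orbits of
rotation number `1/q`: they are `1`-periodic of class `C^{r-4}` and, with a constant `C`
depending only on the table, for every `q ≥ 2` and every periodic orbit of rotation number `1/q`
there is a base phase `θ` such that the Lazutkin parameter `x_k` and the angle `φ_k` of the
`k`-th collision are
`x_k = θ + k/q + α(θ + k/q)/q² + a_k/q⁴` and `φ_k = (μ(x_k)/q)(1 + β(θ + k/q)/q² + b_k/q⁴)`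
with `|a_k|, |b_k| ≤ C`. -/
structure AreLazutkinCoefficients (r : ℕ) (L : ℝ) (γ : ℝ → Plane) (α β : ℝ → ℝ) : Prop where
  periodic_α : Function.Periodic α 1
  periodic_β : Function.Periodic β 1
  contDiff_α : ContDiff ℝ (r - 4 : ℕ) α
  contDiff_β : ContDiff ℝ (r - 4 : ℕ) β
  expansion : ∃ C : ℝ, ∀ q : ℕ, 2 ≤ q → ∀ s φ : ℤ → ℝ, IsPeriodicOrbitOneOver q L γ s φ →
    ∃ θ : ℝ, ∀ k : ℤ, ∃ a b : ℝ, |a| ≤ C ∧ |b| ≤ C ∧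
      lazutkinParam L γ (s k) =
        θ + (k : ℝ) / q + α (θ + (k : ℝ) / q) / (q : ℝ) ^ 2 + a / (q : ℝ) ^ 4 ∧
      φ k = lazutkinDensity L γ (lazutkinParam L γ (s k)) / q *
        (1 + β (θ + (k : ℝ) / q) / (q : ℝ) ^ 2 + b / (q : ℝ) ^ 4)

/-- The Lazutkin parametrization is a bijection of the line. -/
theorem lazutkinParam_bijective {r : ℕ} (hr : 2 ≤ r) {Ω : Set Plane} {L : ℝ} {γ : ℝ → Plane}
    (h : IsConvexBilliardTable r Ω L γ) : Function.Bijective (lazutkinParam L γ) := by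
  have hc1 : ContDiff ℝ 1 (deriv γ) := by
    have : ContDiff ℝ (1 + 1) γ := h.contDiff.of_le (by norm_num; exact_mod_cast hr)
    exact (contDiff_succ_iff_deriv.1 this).2.2
  have hc2 : Continuous (deriv (deriv γ)) := hc1.continuous_deriv le_rfl
  have hpos : ∀ s, 0 < curvRadius γ s := fun s =>
    inv_pos.2 (norm_pos_iff.2 (h.curvature_ne s))
  have hρ : Continuous (curvRadius γ) :=
    hc2.norm.inv₀ fun s => norm_ne_zero_iff.2 (h.curvature_ne s)
  set w : ℝ → ℝ := fun t => curvRadius γ t ^ (-(2 / 3) : ℝ) with hw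
  have hwc : Continuous w := hρ.rpow_const fun s => Or.inl (hpos s).ne'
  have hwpos : ∀ s, 0 < w s := fun s => Real.rpow_pos_of_pos (hpos s) _
  have hwper : Function.Periodic w L := by
    have h1 : Function.Periodic (deriv γ) L := fun s => by
      rw [← deriv_comp_add_const]; congr 1; funext t; exact h.periodic t
    have h2 : Function.Periodic (deriv (deriv γ)) L := fun s => by
      rw [← deriv_comp_add_const]; congr 1; funext t; exact h1 t
    intro s
    simp only [hw, curvRadius, h2 s]
  have hI : 0 < ∫ s in (0 : ℝ)..L, w s :=
    intervalIntegral.intervalIntegral_pos_of_pos (hwc.intervalIntegrable _ _) hwpos h.length_pos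
  have hC : 0 < lazutkinConst L γ := inv_pos.2 hI
  have hint : ∀ a b, IntervalIntegrable w volume a b := fun a b => hwc.intervalIntegrable a b
  have hd : ∀ s, HasDerivAt (lazutkinParam L γ) (lazutkinConst L γ * w s) s := fun s =>
    ((intervalIntegral.integral_hasDerivAt_right (hint 0 s)
      hwc.stronglyMeasurable.stronglyMeasurableAtFilter hwc.continuousAt).const_mul _)
  refine ⟨(strictMono_of_deriv_pos fun s => ?_).injective, ?_⟩
  · rw [(hd s).deriv]; exact mul_pos hC (hwpos s)
  · refine Continuous.surjective
      (continuous_iff_continuousAt.2 fun s => (hd s).continuousAt) ?_ ?_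
    · exact (hwper.tendsto_atTop_intervalIntegral_of_pos hI h.length_pos).const_mul_atTop hC
    · exact (hwper.tendsto_atBot_intervalIntegral_of_pos hI h.length_pos).const_mul_atBot hC

end

/-! Compute the defect `x_{k+1} - x_k - φ_k / μ(x_k)` to order `q⁻³` in two ways. The assumed
expansion, at phases `t` and `t + 1/q`, makes it `(α'(t) - β(t)) / q³ + o(q⁻³)`. Geometry gives the
other value. Let `κ` be the curvature, `c = κ^{1/3}`, and `H` the arclength cut off by the chord.
The angle of the chord with the tangent is `κ H/2 + κ' H²/6 + κ'' H³/24 + o(H³)`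
(`tendsto_chord_angle`). Since `dx/ds = C c²` and `μ = c / (2C)`, the terms in `H` and `H²` cancel
in the defect, which is `C (c c''/12 - c'²/6) H³ + o(H³)` (`tendsto_lazutkin_defect`). As `H ~ 1 /
(C c² q)`, comparison gives `α' - β = (c c''/12 - c'²/6) / (C² c⁶)` (`deriv_sub_eq`), and `ρ = c⁻³`
turns this into the stated formula. The expansion says something only if orbits exist. For each `q ≥
2` an inscribed `q`-gon of maximal perimeter is one (`exists_periodicOrbit`), and its phases are
spaced by `1/q`, so one of them lies within `1/q` of any given `x`. -/

/-! ### Existence of periodic orbits of rotation number `1/q` -/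

/-- Lifts to the line of cyclically ordered inscribed `q`-gons. -/
structure IsInscribedLift (q : ℕ) (L : ℝ) (s : ℤ → ℝ) : Prop where
  mono : Monotone s
  closes : ∀ k, s (k + q) = s k + L

/-- The perimeter of the inscribed `q`-gon with lift `s`. -/
noncomputable def polygonPerimeter (q : ℕ) (γ : ℝ → Plane) (s : ℤ → ℝ) : ℝ :=
  ∑ k ∈ Finset.range q, ‖γ (s (k + 1)) - γ (s k)‖

theorem sum_range_int_shift {q : ℕ} {f : ℤ → ℝ} (hf : ∀ k, f (k + q) = f k) (i : ℤ) :
    ∑ k ∈ Finset.range q, f (k + i) = ∑ k ∈ Finset.range q, f k := by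
  have step : ∀ i : ℤ, ∑ k ∈ Finset.range q, f (k + (i + 1)) = ∑ k ∈ Finset.range q, f (k + i) := by
    intro i
    have h1 := Finset.sum_range_succ (fun k : ℕ => f (k + i)) q
    rw [Finset.sum_range_succ'] at h1
    have h2 : f ((q : ℤ) + i) = f (((0 : ℕ) : ℤ) + i) := by
      rw [add_comm, hf]; simp
    rw [h2] at h1
    have h3 := add_right_cancel h1
    rw [← h3]
    refine Finset.sum_congr rfl fun k _ => ?_
    congr 1; push_cast; ring
  induction i using Int.induction_on with
  | zero => simp
  | succ i ih => rw [step, ih]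
  | pred i ih => rw [← ih, ← step]; simp

namespace IsInscribedLift

variable {q : ℕ} {L : ℝ} {s : ℤ → ℝ} {γ : ℝ → Plane}

theorem apply_add_mul (h : IsInscribedLift q L s) (k m : ℤ) : s (k + q * m) = s k + L * m := by
  induction m using Int.induction_on with
  | zero => simp
  | succ i ih =>
    have : k + q * (i + 1 : ℤ) = (k + q * i) + q := by ring
    rw [this, h.closes, ih]; push_cast; ring
  | pred i ih =>
    have h1 := h.closes (k + q * (-(i : ℤ) - 1))
    have : k + q * (-(i : ℤ) - 1) + q = k + q * (-i : ℤ) := by ring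
    rw [this, ih] at h1
    push_cast at h1 ⊢
    linarith

theorem shift (h : IsInscribedLift q L s) (i : ℤ) : IsInscribedLift q L (fun k => s (k + i)) where
  mono := fun a b hab => h.mono (by omega)
  closes := fun k => by rw [← h.closes]; congr 1; ring

theorem perimeter_shift (h : IsInscribedLift q L s) (hγ : Function.Periodic γ L) (i : ℤ) :
    polygonPerimeter q γ (fun k => s (k + i)) = polygonPerimeter q γ s := by
  have := sum_range_int_shift (q := q) (f := fun k => ‖γ (s (k + 1)) - γ (s k)‖) (fun k => by
    have h1 : s (k + q + 1) = s (k + 1) + L := by rw [← h.closes]; congr 1; ring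
    simp only [h1, h.closes, hγ _]) i
  unfold polygonPerimeter
  rw [← this]
  refine Finset.sum_congr rfl fun k _ => ?_
  simp only
  congr 4
  ring

theorem translate (h : IsInscribedLift q L s) (c : ℝ) : IsInscribedLift q L (fun k => s k + c) where
  mono := fun a b hab => by simpa using h.mono hab
  closes := fun k => by simp only [h.closes]; ring

/-- Weak monotonicity is a closed condition, so the lifts with `s 0 ∈ [0, L]` form a compact set in
the product topology, on which the perimeter is continuous. The price is that vertices may coincide;
`exists_periodicOrbit` excludes this for a maximiser. -/
theorem exists_isMax (hq : 0 < q) (hL : 0 < L) (hγc : Continuous γ) (hγ : Function.Periodic γ L) :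
    ∃ s, IsInscribedLift q L s ∧
      ∀ s', IsInscribedLift q L s' → polygonPerimeter q γ s' ≤ polygonPerimeter q γ s := by
  have hq' : (q : ℤ) ≠ 0 := by exact_mod_cast hq.ne'
  have hqR : (0 : ℝ) < q := by exact_mod_cast hq
  set K : Set (ℤ → ℝ) := {s | IsInscribedLift q L s ∧ s 0 ∈ Icc 0 L} with hK
  have hKc : IsCompact K := by
    -- Since `q (k/q) ≤ k ≤ q (k/q + 1)`, monotonicity and closing confine each `s k` to a fixed
    -- interval of length `2L`.
    have hsub : K ⊆ Set.pi univ
        (fun k : ℤ => Icc (L * (k / q : ℤ) : ℝ) (L * (k / q : ℤ) + 2 * L)) := by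
      rintro s ⟨hs, h0, h1⟩ k -
      have e1 := hs.apply_add_mul 0 (k / q)
      have e2 := hs.apply_add_mul 0 (k / q + 1)
      rw [zero_add] at e1 e2
      have l1 : s (q * (k / q)) ≤ s k := hs.mono (Int.mul_ediv_self_le hq')
      have l2 : s k ≤ s (q * (k / q + 1)) := by
        refine hs.mono ?_
        have := Int.lt_mul_ediv_self_add (x := k) (k := q) (by omega)
        rw [mul_add]; omega
      push_cast at e2
      constructor <;> nlinarith
    refine (isCompact_univ_pi fun k => isCompact_Icc).of_isClosed_subset ?_ hsub
    have : K = (⋂ (a : ℤ) (b : ℤ) (_ : a ≤ b), {s : ℤ → ℝ | s a ≤ s b}) ∩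
        (⋂ k : ℤ, {s : ℤ → ℝ | s (k + q) = s k + L}) ∩ {s | s 0 ∈ Icc 0 L} := by
      ext s
      simp only [hK, mem_ofPred_eq, mem_inter_iff, mem_iInter]
      exact ⟨fun h => ⟨⟨fun a b hab => h.1.mono hab, h.1.closes⟩, h.2⟩,
        fun h => ⟨⟨fun a b hab => h.1.1 a b hab, h.1.2⟩, h.2⟩⟩
    rw [this]
    refine (IsClosed.inter ?_ ?_).inter ?_
    · exact isClosed_iInter fun a => isClosed_iInter fun b => isClosed_iInter fun _ =>
        isClosed_le (continuous_apply a) (continuous_apply b)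
    · exact isClosed_iInter fun k =>
        isClosed_eq (continuous_apply _) ((continuous_apply k).add continuous_const)
    · exact isClosed_Icc.preimage (continuous_apply 0)
  have hne : K.Nonempty := by
    refine ⟨fun k => L * k / q, ⟨fun a b hab => ?_, fun k => ?_⟩, ?_⟩
    · have : (a : ℝ) ≤ b := by exact_mod_cast hab
      gcongr
    · push_cast; field_simp
    · simp [hL.le]
  have hcont : Continuous (polygonPerimeter q γ) := by
    unfold polygonPerimeter
    fun_prop
  obtain ⟨s, hsK, hs⟩ := hKc.exists_isMaxOn hne hcont.continuousOn
  refine ⟨s, hsK.1, fun s' hs' => ?_⟩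
  -- Translation by a multiple of `L` brings any lift into `K` without changing its polygon.
  set m : ℤ := -⌊s' 0 / L⌋
  have key : (fun k => s' k + L * m) ∈ K := by
    refine ⟨hs'.translate _, ?_⟩
    have h1 := Int.floor_le (s' 0 / L)
    have h2 := (Int.lt_floor_add_one (s' 0 / L)).le
    rw [le_div_iff₀ hL] at h1
    rw [div_le_iff₀ hL] at h2
    simp only [m]; push_cast
    constructor <;> nlinarith
  have hle := hs key
  have heq : polygonPerimeter q γ (fun k => s' k + L * m) = polygonPerimeter q γ s' := by
    unfold polygonPerimeter
    refine Finset.sum_congr rfl fun k _ => ?_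
    have hm : ∀ t, γ (t + L * m) = γ t := fun t => by
      rw [mul_comm]; exact hγ.int_mul m t
    simp only [hm]
  rw [← heq]; exact hle

/-- Moving one vertex of an inscribed polygon with at least two vertices. -/
theorem exists_move (h : IsInscribedLift q L s) (hq : 2 ≤ q) {t : ℝ}
    (ht0 : s 0 ≤ t) (ht2 : t ≤ s 2) :
    ∃ s', IsInscribedLift q L s' ∧ polygonPerimeter q γ s' =
      polygonPerimeter q γ s - (‖γ (s 1) - γ (s 0)‖ + ‖γ (s 2) - γ (s 1)‖)
        + (‖γ t - γ (s 0)‖ + ‖γ (s 2) - γ t‖) := by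
  classical
  have hqpos : (0 : ℤ) < q := by omega
  have hnd : ∀ j : ℤ, (q : ℤ) ∣ j → ¬ (q : ℤ) ∣ j + 1 := fun j h1 h2 => by
    have : (q : ℤ) ∣ 1 := by simpa using dvd_sub h2 h1
    have := Int.le_of_dvd one_pos this
    omega
  -- The vertex of index 1 moves together with all its translates, the indices congruent to 1 mod
  -- `q`. As `q ≥ 2`, no two adjacent indices move.
  set s' : ℤ → ℝ := fun j => if (q : ℤ) ∣ j - 1 then t + L * ((j - 1) / q : ℤ) else s j with hs'
  have e1 : ∀ j, (q : ℤ) ∣ j - 1 → s' j = t + L * ((j - 1) / q : ℤ) := fun j hj => if_pos hj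
  have e2 : ∀ j, ¬ (q : ℤ) ∣ j - 1 → s' j = s j := fun j hj => if_neg hj
  have hw : IsInscribedLift q L s' := by
    refine ⟨monotone_int_of_le_succ fun j => ?_, fun j => ?_⟩
    · by_cases h1 : (q : ℤ) ∣ j - 1
      · have h2 : ¬ (q : ℤ) ∣ j + 1 - 1 := by
          have := hnd _ h1
          rwa [show j + 1 - 1 = j - 1 + 1 by ring]
        rw [e1 _ h1, e2 _ h2]
        obtain ⟨m, hm⟩ := h1
        rw [hm, Int.mul_ediv_cancel_left _ hqpos.ne', show j + 1 = 2 + q * m by omega,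
          h.apply_add_mul]
        linarith
      · rw [e2 _ h1]
        by_cases h2 : (q : ℤ) ∣ j + 1 - 1
        · rw [e1 _ h2]
          obtain ⟨m, hm⟩ := h2
          rw [hm, Int.mul_ediv_cancel_left _ hqpos.ne', show j = 0 + q * m by omega,
            h.apply_add_mul]
          linarith
        · rw [e2 _ h2]
          exact h.mono (by omega)
    · by_cases h1 : (q : ℤ) ∣ j - 1
      · have h2 : (q : ℤ) ∣ j + q - 1 := by
          rw [show j + (q : ℤ) - 1 = (j - 1) + q by ring]
          exact dvd_add h1 dvd_rfl
        rw [e1 _ h1, e1 _ h2]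
        obtain ⟨m, hm⟩ := h1
        rw [show j + (q : ℤ) - 1 = q * (m + 1) by rw [mul_add, ← hm]; ring, hm,
          Int.mul_ediv_cancel_left _ hqpos.ne', Int.mul_ediv_cancel_left _ hqpos.ne']
        push_cast; ring
      · have h2 : ¬ (q : ℤ) ∣ j + q - 1 := by
          rw [show j + (q : ℤ) - 1 = (j - 1) + q by ring]
          simpa using h1
        rw [e2 _ h1, e2 _ h2, h.closes]
  have hsmall : ∀ j : ℤ, 2 ≤ j → j ≤ q → s' j = s j := fun j h2 hj => e2 _ fun hd => by
    have := Int.le_of_dvd (by omega) hd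
    omega
  have h0 : s' 0 = s 0 := e2 _ fun hd => by
    have : (q : ℤ) ∣ 1 := by simpa using hd
    have := Int.le_of_dvd one_pos this
    omega
  have h1 : s' 1 = t := by rw [e1 _ (by simp)]; simp
  have h2 : s' 2 = s 2 := hsmall 2 le_rfl (by omega)
  refine ⟨s', hw, ?_⟩
  -- Only the edges 0 and 1 change, so they are split off the sum.
  obtain ⟨p, rfl⟩ : ∃ p, q = p + 2 := ⟨q - 2, by omega⟩
  unfold polygonPerimeter
  rw [Finset.sum_range_succ', Finset.sum_range_succ', Finset.sum_range_succ' _ (p + 1),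
    Finset.sum_range_succ' _ p]
  have hrest : ∑ k ∈ Finset.range p, ‖γ (s' (((k + 1 + 1 : ℕ) : ℤ) + 1)) - γ (s' ((k + 1 + 1 : ℕ) : ℤ))‖
      = ∑ k ∈ Finset.range p, ‖γ (s (((k + 1 + 1 : ℕ) : ℤ) + 1)) - γ (s ((k + 1 + 1 : ℕ) : ℤ))‖ := by
    refine Finset.sum_congr rfl fun k hk => ?_
    rw [Finset.mem_range] at hk
    rw [hsmall _ (by push_cast; omega) (by push_cast; omega),
      hsmall _ (by push_cast; omega) (by push_cast; omega)]
  rw [hrest]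
  norm_num [h0, h1, h2]
  ring

end IsInscribedLift

/-! ### Derivatives of coordinates and of lengths -/

theorem HasDerivAt.coord {γ : ℝ → Plane} {v : Plane} {t : ℝ} (h : HasDerivAt γ v t) (i : Fin 2) :
    HasDerivAt (fun s => γ s i) (v i) t :=
  (EuclideanSpace.proj (𝕜 := ℝ) i : Plane →L[ℝ] ℝ).hasFDerivAt.comp_hasDerivAt t h

theorem Plane.inner_eq (v w : Plane) : inner ℝ v w = v 0 * w 0 + v 1 * w 1 := by
  simp [PiLp.inner_apply, Fin.sum_univ_two, mul_comm]

theorem Plane.norm_sq_eq (v : Plane) : ‖v‖ ^ 2 = v 0 ^ 2 + v 1 ^ 2 := by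
  rw [EuclideanSpace.norm_sq_eq]; simp [Fin.sum_univ_two]

/-- The derivative of the length of a moving nonzero vector. -/
theorem hasDerivAt_norm_of_ne_zero {f : ℝ → Plane} {v : Plane} {t : ℝ} (h : HasDerivAt f v t)
    (h0 : f t ≠ 0) : HasDerivAt (fun s => ‖f s‖) (inner ℝ v (f t) / ‖f t‖) t := by
  have h1 := h.norm_sq.sqrt (by positivity)
  simp only [Real.sqrt_sq (norm_nonneg _)] at h1
  convert h1 using 1
  rw [real_inner_comm]
  field_simp

/-! ### Chords of the table, and the maximal polygon as a billiard orbit -/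

namespace IsConvexBilliardTable

variable {r : ℕ} {Ω : Set Plane} {L : ℝ} {γ : ℝ → Plane}

theorem contDiff_deriv (h : IsConvexBilliardTable r Ω L γ) {n : ℕ} (hn : n + 1 ≤ r) :
    ContDiff ℝ n (deriv γ) := by
  have : ContDiff ℝ ((n : WithTop ℕ∞) + 1) γ := h.contDiff.of_le (by exact_mod_cast hn)
  exact (contDiff_succ_iff_deriv.1 this).2.2

theorem contDiff_deriv2 (h : IsConvexBilliardTable r Ω L γ) {n : ℕ} (hn : n + 2 ≤ r) :
    ContDiff ℝ n (deriv (deriv γ)) := by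
  have : ContDiff ℝ ((n : WithTop ℕ∞) + 1) (deriv γ) := by
    exact_mod_cast h.contDiff_deriv (n := n + 1) (by omega)
  exact (contDiff_succ_iff_deriv.1 this).2.2

theorem hasDerivAt (h : IsConvexBilliardTable r Ω L γ) (hr : 2 ≤ r) (s : ℝ) :
    HasDerivAt γ (deriv γ s) s :=
  (h.contDiff.differentiable (by exact_mod_cast (by omega : r ≠ 0)) s).hasDerivAt

theorem hasDerivAt_deriv (h : IsConvexBilliardTable r Ω L γ) (hr : 2 ≤ r) (s : ℝ) :
    HasDerivAt (deriv γ) (deriv (deriv γ) s) s :=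
  ((h.contDiff_deriv (n := 1) hr).differentiable (by simp) s).hasDerivAt

theorem tangent_sq (h : IsConvexBilliardTable r Ω L γ) (s : ℝ) :
    deriv γ s 0 ^ 2 + deriv γ s 1 ^ 2 = 1 := by
  rw [← Plane.norm_sq_eq, h.unit_speed]; norm_num

theorem tangent_orthogonal (h : IsConvexBilliardTable r Ω L γ) (hr : 2 ≤ r) (s : ℝ) :
    deriv γ s 0 * deriv (deriv γ) s 0 + deriv γ s 1 * deriv (deriv γ) s 1 = 0 := by
  have h0 := (h.hasDerivAt_deriv hr s).coord 0
  have h1 := (h.hasDerivAt_deriv hr s).coord 1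
  have h2 := ((h0.fun_pow 2).add (h1.fun_pow 2)).unique
    ((hasDerivAt_const s (1 : ℝ)).congr_of_eventuallyEq (Eventually.of_forall h.tangent_sq))
  norm_num at h2
  linarith

theorem chord_ne_zero (h : IsConvexBilliardTable r Ω L γ) {a b : ℝ} (hab : a < b) (hb : b < a + L) :
    γ b - γ a ≠ 0 := by
  rw [sub_ne_zero]
  intro heq
  have hL := h.length_pos
  set m := ⌊a / L⌋
  have h1 := Int.floor_le (a / L)
  have h2 := Int.lt_floor_add_one (a / L)
  rw [le_div_iff₀ hL] at h1
  rw [div_lt_iff₀ hL] at h2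
  have hm : ∀ t, γ (t - m * L) = γ t := fun t => h.periodic.sub_int_mul_eq m
  have ha : a - m * L ∈ Ico 0 L := ⟨by linarith, by linarith⟩
  -- After reduction of `a` into `[0, L)`, the point `b` lies in the same period or in the next one.
  by_cases hc : b - m * L < L
  · have := h.injOn ⟨by linarith [ha.1], hc⟩ ha (by rw [hm, hm, heq])
    linarith
  · have := h.injOn (x₁ := b - m * L - L) ⟨by linarith, by linarith [ha.2]⟩ ha
      (by rw [h.periodic.sub_eq, hm, hm, heq])
    linarith

/-- No arc of the boundary is contained in its chord. -/
theorem exists_lt_add_of_chord (h : IsConvexBilliardTable r Ω L γ) (hr : 2 ≤ r) {a b : ℝ}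
    (hab : a < b) :
    ∃ t ∈ Ioo a b, ‖γ b - γ a‖ < ‖γ t - γ a‖ + ‖γ b - γ t‖ := by
  by_contra! hcon
  -- Equality in the triangle inequality would put the whole arc on one line, of direction `d`. Two
  -- differentiations then make `γ'` and `γ''` parallel; being also orthogonal, they force `γ'' =
  -- 0`.
  obtain ⟨d, hd⟩ : ∃ d : Plane, d ≠ 0 ∧ ∀ t ∈ Ioo a b, ∃ c : ℝ, γ t - γ a = c • d := by
    have hw : ∀ t ∈ Ioo a b, Wbtw ℝ (γ a) (γ t) (γ b) := fun t ht => by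
      rw [← dist_add_dist_eq_iff, dist_eq_norm', dist_eq_norm', dist_eq_norm']
      refine le_antisymm (hcon t ht) ?_
      calc ‖γ b - γ a‖ = ‖(γ t - γ a) + (γ b - γ t)‖ := by congr 1; abel
        _ ≤ _ := norm_add_le _ _
    by_cases hd : γ b - γ a = 0
    · refine ⟨EuclideanSpace.single 0 1, by simp, fun t ht => ⟨0, ?_⟩⟩
      obtain ⟨c, -, hc⟩ := hw t ht
      rw [← hc, AffineMap.lineMap_apply, vsub_eq_sub, hd]
      simp
    · refine ⟨γ b - γ a, hd, fun t ht => ?_⟩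
      obtain ⟨c, -, hc⟩ := hw t ht
      refine ⟨c, ?_⟩
      rw [← hc, AffineMap.lineMap_apply]
      simp
  obtain ⟨hd0, hd⟩ := hd
  have hz0 : ∀ t ∈ Ioo a b, (γ t 0 - γ a 0) * d 1 - (γ t 1 - γ a 1) * d 0 = 0 := fun t ht => by
    obtain ⟨c, hc⟩ := hd t ht
    have e0 : γ t 0 - γ a 0 = c * d 0 := by simpa using congrArg (fun v : Plane => v 0) hc
    have e1 : γ t 1 - γ a 1 = c * d 1 := by simpa using congrArg (fun v : Plane => v 1) hc
    rw [e0, e1]; ring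
  have hz1 : ∀ t ∈ Ioo a b, deriv γ t 0 * d 1 - deriv γ t 1 * d 0 = 0 := fun t ht => by
    have h0 := (h.hasDerivAt hr t).coord 0
    have h1 := (h.hasDerivAt hr t).coord 1
    exact ((((h0.sub_const (γ a 0)).mul_const (d 1)).sub
      ((h1.sub_const (γ a 1)).mul_const (d 0)))).unique
      ((hasDerivAt_const t (0 : ℝ)).congr_of_eventuallyEq
        (eventually_of_mem (isOpen_Ioo.mem_nhds ht) hz0))
  have hz2 : ∀ t ∈ Ioo a b, deriv (deriv γ) t 0 * d 1 - deriv (deriv γ) t 1 * d 0 = 0 :=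
    fun t ht => by
    have h0 := (h.hasDerivAt_deriv hr t).coord 0
    have h1 := (h.hasDerivAt_deriv hr t).coord 1
    exact ((h0.mul_const (d 1)).sub (h1.mul_const (d 0))).unique
      ((hasDerivAt_const t (0 : ℝ)).congr_of_eventuallyEq
        (eventually_of_mem (isOpen_Ioo.mem_nhds ht) hz1))
  obtain ⟨t, ht⟩ := nonempty_Ioo.2 hab
  have e1 := hz1 t ht
  have e2 := hz2 t ht
  have e3 := h.tangent_sq t
  have e4 := h.tangent_orthogonal hr t
  set p := deriv γ t 0
  set p' := deriv γ t 1
  set n := deriv (deriv γ) t 0 with hn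
  set n' := deriv (deriv γ) t 1 with hn'
  have hdsq : 0 < d 0 ^ 2 + d 1 ^ 2 := by
    rw [← Plane.norm_sq_eq]; positivity
  have hcross : p * n' - p' * n = 0 := by
    have : (p * n' - p' * n) * (d 0 ^ 2 + d 1 ^ 2) = 0 := by
      linear_combination (n' * d 1 + n * d 0) * e1 - (p * d 0 + p' * d 1) * e2
    exact (mul_eq_zero.1 this).resolve_right hdsq.ne'
  apply h.curvature_ne t
  rw [← norm_eq_zero, ← sq_eq_zero_iff, Plane.norm_sq_eq, ← hn, ← hn']
  linear_combination (p * n' - p' * n) * hcross + (p * n + p' * n') * e4 - (n ^ 2 + n' ^ 2) * e3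

/-- Existence of a periodic billiard orbit of rotation number `1/q`: the inscribed `q`-gon of
maximal perimeter. -/
theorem exists_periodicOrbit (h : IsConvexBilliardTable r Ω L γ) (hr : 2 ≤ r) {q : ℕ}
    (hq : 2 ≤ q) : ∃ s φ : ℤ → ℝ, IsPeriodicOrbitOneOver q L γ s φ := by
  obtain ⟨s, hs, hmax⟩ := IsInscribedLift.exists_isMax (by omega) h.length_pos
    h.contDiff.continuous h.periodic (q := q)
  have hmove : ∀ i, ∀ t ∈ Icc (s i) (s (i + 2)),
      ‖γ t - γ (s i)‖ + ‖γ (s (i + 2)) - γ t‖ ≤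
        ‖γ (s (i + 1)) - γ (s i)‖ + ‖γ (s (i + 2)) - γ (s (i + 1))‖ := by
    intro i t ht
    obtain ⟨s', hs', hp⟩ := (hs.shift i).exists_move hq (γ := γ) (t := t)
      (by simpa using ht.1) (by rw [add_comm]; exact ht.2)
    have := hmax s' hs'
    rw [hp, hs.perimeter_shift h.periodic] at this
    simp only [add_comm _ i, add_zero] at this
    linarith
  -- If two successive vertices coincide, the next edge is degenerate too: otherwise moving the
  -- doubled vertex into the next arc would lengthen the polygon. The collapse propagates through
  -- `q` steps and contradicts `s (k + q) = s k + L`.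
  have hstrict : ∀ k, s k < s (k + 1) := by
    by_contra! hcon
    obtain ⟨k, hk⟩ := hcon
    have hk : s (k + 1) = s k := le_antisymm hk (hs.mono (by omega))
    have hall : ∀ n : ℕ, s (k + n + 1) = s (k + n) := by
      intro n
      induction n with
      | zero => simpa using hk
      | succ n ih =>
        by_contra hne
        have hlt : s (k + n + 1) < s (k + n + 2) :=
          lt_of_le_of_ne (hs.mono (by omega)) fun he => hne (by
            push_cast
            rw [show k + ((n : ℤ) + 1) + 1 = k + n + 2 by ring, ← he]
            congr 1; ring)
        rw [ih] at hlt
        obtain ⟨t, ht, hl⟩ := h.exists_lt_add_of_chord hr hlt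
        have := hmove (k + n) t ⟨ht.1.le, ht.2.le⟩
        rw [ih, sub_self, norm_zero, zero_add] at this
        linarith
    have hconst : ∀ n : ℕ, s (k + n) = s k := by
      intro n
      induction n with
      | zero => simp
      | succ n ih =>
        rw [← ih, ← hall n]; congr 1; push_cast; ring
    have h1 := hs.closes k
    rw [hconst q] at h1
    linarith [h.length_pos]
  have hmono : StrictMono s := strictMono_int_of_lt_succ hstrict
  have hadv : ∀ k, s (k + 1) < s k + L := fun k => by
    rw [← hs.closes]; exact hmono (by omega)
  refine ⟨s, fun k => InnerProductGeometry.angle (deriv γ (s k)) (γ (s (k + 1)) - γ (s k)),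
    ⟨⟨fun k => ⟨hstrict k, hadv k⟩, fun k => rfl, fun k => ?_⟩, hs.closes⟩⟩
  have n1 : γ (s k) - γ (s (k - 1)) ≠ 0 := h.chord_ne_zero (hmono (by omega))
    (by simpa using hadv (k - 1))
  have n2 : γ (s (k + 1)) - γ (s k) ≠ 0 := h.chord_ne_zero (hstrict k) (hadv k)
  have d1 := hasDerivAt_norm_of_ne_zero ((h.hasDerivAt hr (s k)).sub_const (γ (s (k - 1)))) n1
  have d2 := hasDerivAt_norm_of_ne_zero ((h.hasDerivAt hr (s k)).const_sub (γ (s (k + 1)))) n2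
  have hloc : IsLocalMax
      (fun t => ‖γ t - γ (s (k - 1))‖ + ‖γ (s (k + 1)) - γ t‖) (s k) := by
    filter_upwards [Ioo_mem_nhds (hmono (show k - 1 < k by omega)) (hstrict k)] with t ht
    have := hmove (k - 1) t
    rw [show k - 1 + 2 = k + 1 by ring, show k - 1 + 1 = k by ring] at this
    exact this ⟨ht.1.le, ht.2.le⟩
  -- The derivative in one vertex is the cosine of the incoming angle minus that of the outgoing
  -- one, so criticality is the reflection law.
  have hzero := hloc.hasDerivAt_eq_zero (d1.add d2)
  unfold InnerProductGeometry.angle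
  congr 1
  rw [h.unit_speed, one_mul, one_mul]
  rw [inner_neg_left, neg_div] at hzero
  linarith

end IsConvexBilliardTable

/-! ### Expansion of the angle between the tangent and a short chord -/

open scoped Nat Topology in
/-- Taylor's formula with a remainder controlled locally uniformly in the base point. -/
theorem tendsto_taylor_remainder {ι : Type*} {l : Filter ι} {f : ℝ → ℝ} {n : ℕ}
    (hf : ContDiff ℝ (n + 1) f) {s₀ : ℝ} {S H : ι → ℝ} (hS : Tendsto S l (𝓝 s₀))
    (hH : Tendsto H l (𝓝 0)) (hpos : ∀ᶠ i in l, 0 < H i) :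
    Tendsto (fun i => (f (S i + H i) -
      ∑ k ∈ Finset.range (n + 1), ((k ! : ℝ)⁻¹ * H i ^ k) * iteratedDeriv k f (S i)) / H i ^ (n + 1))
      l (𝓝 (iteratedDeriv (n + 1) f s₀ / (n + 1)!)) := by
  have hex : ∀ i, ∃ ξ, 0 < H i → (S i ≤ ξ ∧ ξ ≤ S i + H i) ∧ (f (S i + H i) -
      ∑ k ∈ Finset.range (n + 1), ((k ! : ℝ)⁻¹ * H i ^ k) * iteratedDeriv k f (S i)) / H i ^ (n + 1)
      = iteratedDeriv (n + 1) f ξ / (n + 1)! := by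
    intro i
    by_cases hi : 0 < H i
    · have hne : S i ≠ S i + H i := by linarith
      obtain ⟨ξ, hξ, he⟩ := taylor_mean_remainder_lagrange_iteratedDeriv hne
        (hf.contDiffOn (s := uIcc (S i) (S i + H i)))
      refine ⟨ξ, fun _ => ⟨?_, ?_⟩⟩
      · rw [uIoo_of_lt (by linarith)] at hξ
        exact ⟨hξ.1.le, hξ.2.le⟩
      · rw [taylor_within_apply, add_sub_cancel_left] at he
        have hsum : ∑ k ∈ Finset.range (n + 1), ((k ! : ℝ)⁻¹ * H i ^ k) •
            iteratedDerivWithin k f (uIcc (S i) (S i + H i)) (S i) =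
            ∑ k ∈ Finset.range (n + 1), ((k ! : ℝ)⁻¹ * H i ^ k) * iteratedDeriv k f (S i) := by
          refine Finset.sum_congr rfl fun k hk => ?_
          rw [iteratedDerivWithin_eq_iteratedDeriv (uniqueDiffOn_uIcc hne) _ left_mem_uIcc,
            smul_eq_mul]
          rw [Finset.mem_range] at hk
          exact (hf.of_le (by exact_mod_cast hk.le)).contDiffAt
        rw [hsum] at he
        rw [he]
        field_simp
    -- A dummy value: positivity of `H i` holds only eventually.
    · exact ⟨0, fun h => absurd h hi⟩
  choose ξ hξ using hex
  have hlim : Tendsto ξ l (𝓝 s₀) := by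
    refine tendsto_of_tendsto_of_tendsto_of_le_of_le' hS (by simpa using hS.add hH)
      (hpos.mono fun i hi => (hξ i hi).1.1) (hpos.mono fun i hi => (hξ i hi).1.2)
  have hcont : Continuous (iteratedDeriv (n + 1) f) :=
    hf.continuous_iteratedDeriv _ (by norm_cast)
  refine (((hcont.tendsto s₀).comp hlim).div_const _).congr' ?_
  filter_upwards [hpos] with i hi
  exact (hξ i hi).2.symm

open scoped Topology in
theorem tendsto_arctan_sub_div_cube {ι : Type*} {l : Filter ι} {y : ι → ℝ}
    (hy : Tendsto y l (𝓝 0)) (hpos : ∀ᶠ i in l, 0 < y i) :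
    Tendsto (fun i => (Real.arctan (y i) - y i) / y i ^ 3) l (𝓝 (-(1 / 3))) := by
  have h := tendsto_taylor_remainder (n := 2) (f := Real.arctan) (s₀ := 0) (S := fun _ => 0)
    Real.contDiff_arctan tendsto_const_nhds hy hpos
  have d1 : deriv Real.arctan = fun x => (1 + x ^ 2)⁻¹ := by
    rw [Real.deriv_arctan]; ext x; simp
  have d2 : deriv (fun x : ℝ => (1 + x ^ 2)⁻¹) = fun x => -(2 * x) / (1 + x ^ 2) ^ 2 := by
    ext x
    have := (((hasDerivAt_id x).fun_pow 2).const_add 1).fun_inv (by simp; positivity)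
    simpa using this.deriv
  have d3 : deriv (fun x : ℝ => -(2 * x) / (1 + x ^ 2) ^ 2) 0 = -2 := by
    have h1 := (((hasDerivAt_id (0 : ℝ)).fun_pow 2).const_add 1).fun_pow 2
    have h2 := (((hasDerivAt_id (0 : ℝ)).const_mul 2).fun_neg).fun_div h1 (by simp)
    simpa using h2.deriv
  simp only [Finset.sum_range_succ, Finset.sum_range_zero, iteratedDeriv_succ, iteratedDeriv_zero,
    d1, d2, d3] at h
  norm_num at h
  convert h using 2

namespace IsConvexBilliardTable

variable {r : ℕ} {Ω : Set Plane} {L : ℝ} {γ : ℝ → Plane}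

theorem contDiff_curvature (h : IsConvexBilliardTable r Ω L γ) {n : ℕ} (hn : n + 2 ≤ r) :
    ContDiff ℝ n (fun s => ‖deriv (deriv γ) s‖) :=
  (h.contDiff_deriv2 hn).norm ℝ h.curvature_ne

/-- The Frenet equation; the sign `ε` is the orientation of the parametrization. -/
theorem exists_frenet (h : IsConvexBilliardTable r Ω L γ) (hr : 2 ≤ r) :
    ∃ ε : ℝ, ε ^ 2 = 1 ∧ ∀ s, deriv (deriv γ) s 0 = -(ε * ‖deriv (deriv γ) s‖ * deriv γ s 1) ∧
      deriv (deriv γ) s 1 = ε * ‖deriv (deriv γ) s‖ * deriv γ s 0 := by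
  have hc : ∀ i : Fin 2, Continuous fun s => deriv γ s i := fun i =>
    continuous_iff_continuousAt.2 fun s => ((h.hasDerivAt_deriv hr s).coord i).continuousAt
  have hc2 : Continuous (deriv (deriv γ)) := (h.contDiff_deriv2 (n := 0) hr).continuous
  have hc2' : ∀ i : Fin 2, Continuous fun s => deriv (deriv γ) s i := fun i =>
    (EuclideanSpace.proj (𝕜 := ℝ) i : Plane →L[ℝ] ℝ).continuous.comp hc2
  set k : ℝ → ℝ := fun s => deriv γ s 0 * deriv (deriv γ) s 1 - deriv γ s 1 * deriv (deriv γ) s 0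
    with hk
  have hsq : ∀ s, k s ^ 2 = ‖deriv (deriv γ) s‖ ^ 2 := fun s => by
    have e1 := h.tangent_sq s
    have e2 := h.tangent_orthogonal hr s
    rw [Plane.norm_sq_eq, hk]
    linear_combination (deriv (deriv γ) s 0 ^ 2 + deriv (deriv γ) s 1 ^ 2) * e1 -
      (deriv γ s 0 * deriv (deriv γ) s 0 + deriv γ s 1 * deriv (deriv γ) s 1) * e2
  have hk0 : ∀ s, deriv (deriv γ) s 0 = -(k s * deriv γ s 1) := fun s => by
    have e1 := h.tangent_sq s
    have e2 := h.tangent_orthogonal hr s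
    simp only [hk]
    linear_combination deriv γ s 0 * e2 - deriv (deriv γ) s 0 * e1
  have hk1 : ∀ s, deriv (deriv γ) s 1 = k s * deriv γ s 0 := fun s => by
    have e1 := h.tangent_sq s
    have e2 := h.tangent_orthogonal hr s
    simp only [hk]
    linear_combination deriv γ s 1 * e2 - deriv (deriv γ) s 1 * e1
  have hkc : Continuous k := ((hc 0).mul (hc2' 1)).sub ((hc 1).mul (hc2' 0))
  -- The signed curvature `k` is continuous with `k² = ‖γ''‖² ≠ 0`, so it keeps one sign on the
  -- line.
  rcases isPreconnected_univ.eq_or_eq_neg_of_sq_eq hkc.continuousOn hc2.norm.continuousOn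
    (fun s _ => hsq s) (fun {s} _ => norm_ne_zero_iff.2 (h.curvature_ne s)) with he | he
  · refine ⟨1, by norm_num, fun s => ?_⟩
    have : k s = ‖deriv (deriv γ) s‖ := he (mem_univ s)
    rw [one_mul, ← this]
    exact ⟨hk0 s, hk1 s⟩
  · refine ⟨-1, by norm_num, fun s => ?_⟩
    have : k s = -‖deriv (deriv γ) s‖ := he (mem_univ s)
    rw [neg_one_mul, ← this]
    exact ⟨hk0 s, hk1 s⟩

end IsConvexBilliardTable

open scoped Topology in
-- The quotient is the slope of a chord against the tangent, with scaled remainders `U` along and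
-- `W` across. The cubic coefficient collects `w` from the numerator, `κ³/12` from the denominator
-- and `-κ³/24` from `arctan y = y - y³/3 + ⋯`. The lower coefficients stay at the moving base
-- point, since their errors would not be `o(H³)`.
theorem tendsto_arctan_quotient {ι : Type*} {l : Filter ι} {H U W K K' : ι → ℝ} {κ κ' w : ℝ}
    (hκ : 0 < κ) (hH : Tendsto H l (𝓝 0)) (hpos : ∀ᶠ i in l, 0 < H i)
    (hU : Tendsto U l (𝓝 (-κ ^ 2 / 6))) (hW : Tendsto W l (𝓝 w)) (hK : Tendsto K l (𝓝 κ))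
    (hK' : Tendsto K' l (𝓝 κ')) :
    Tendsto (fun i => (Real.arctan ((H i * K i / 2 + H i ^ 2 * K' i / 6 + H i ^ 3 * W i) /
        (1 + H i ^ 2 * U i)) - K i * H i / 2 - K' i * H i ^ 2 / 6) / H i ^ 3) l
      (𝓝 (w + κ ^ 3 / 24)) := by
  set y : ι → ℝ := fun i => (H i * K i / 2 + H i ^ 2 * K' i / 6 + H i ^ 3 * W i) /
    (1 + H i ^ 2 * U i) with hy
  have hden : Tendsto (fun i => 1 + H i ^ 2 * U i) l (𝓝 1) := by
    simpa using ((hH.pow 2).mul hU).const_add 1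
  have hden0 : ∀ᶠ i in l, 0 < 1 + H i ^ 2 * U i := hden.eventually (lt_mem_nhds one_pos)
  have hyH : Tendsto (fun i => y i / H i) l (𝓝 (κ / 2)) := by
    have : Tendsto (fun i => (K i / 2 + H i * K' i / 6 + H i ^ 2 * W i) / (1 + H i ^ 2 * U i)) l
        (𝓝 (κ / 2)) := by
      simpa [Pi.div_def] using ((((hK.div_const 2).add ((hH.mul hK').div_const 6)).add
        ((hH.pow 2).mul hW)).div hden one_ne_zero)
    refine this.congr' ?_
    filter_upwards [hpos, hden0] with i hi hi'
    simp only [hy]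
    field_simp
  have hy0 : Tendsto y l (𝓝 0) := by
    have := hyH.mul hH
    rw [mul_zero] at this
    refine this.congr' ?_
    filter_upwards [hpos] with i hi
    field_simp
  have hypos : ∀ᶠ i in l, 0 < y i := by
    filter_upwards [hpos, hyH.eventually (lt_mem_nhds (half_pos hκ))] with i hi hi'
    exact (div_pos_iff_of_pos_right hi).1 hi'
  have h1 := (tendsto_arctan_sub_div_cube hy0 hypos).mul (hyH.pow 3)
  have h2 : Tendsto (fun i => (W i - U i * (K i / 2 + H i * K' i / 6)) / (1 + H i ^ 2 * U i)) l
      (𝓝 (w - -κ ^ 2 / 6 * (κ / 2))) := by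
    simpa [Pi.div_def] using (hW.sub (hU.mul ((hK.div_const 2).add ((hH.mul hK').div_const 6)))).div hden
      one_ne_zero
  have h3 := h1.add h2
  rw [show -(1 / 3) * (κ / 2) ^ 3 + (w - -κ ^ 2 / 6 * (κ / 2)) = w + κ ^ 3 / 24 by ring] at h3
  refine h3.congr' ?_
  filter_upwards [hpos, hden0, hypos] with i hi hi' hi''
  have e : y i * (1 + H i ^ 2 * U i) = H i * K i / 2 + H i ^ 2 * K' i / 6 + H i ^ 3 * W i :=
    div_mul_cancel₀ _ hi'.ne'
  have e2 : (W i - U i * (K i / 2 + H i * K' i / 6)) / (1 + H i ^ 2 * U i) =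
      (y i - K i * H i / 2 - K' i * H i ^ 2 / 6) / H i ^ 3 := by
    rw [div_eq_div_iff hi'.ne' (by positivity)]
    linear_combination -e
  rw [e2]
  change _ = (Real.arctan (y i) - _ - _) / _
  field_simp
  ring

/-- The angle of two vectors in terms of the coordinates of the second along and across the
first. -/
theorem Plane.angle_eq_arctan {v w : Plane} (hv : ‖v‖ = 1) {ε : ℝ} (hε : ε ^ 2 = 1)
    (hpos : 0 < v 0 * w 0 + v 1 * w 1) (hcross : 0 ≤ ε * (v 0 * w 1 - v 1 * w 0)) :
    InnerProductGeometry.angle v w =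
      Real.arctan (ε * (v 0 * w 1 - v 1 * w 0) / (v 0 * w 0 + v 1 * w 1)) := by
  have hv2 : v 0 ^ 2 + v 1 ^ 2 = 1 := by rw [← Plane.norm_sq_eq, hv]; norm_num
  have hw : 0 < ‖w‖ := by
    rw [norm_pos_iff]
    rintro rfl
    simp at hpos
  have hw2 := Plane.norm_sq_eq w
  unfold InnerProductGeometry.angle
  rw [Plane.inner_eq, hv, one_mul, Real.arccos_eq_arctan (div_pos hpos hw)]
  -- Lagrange's identity: dot product squared plus cross product squared is `‖w‖²` for unit `v`.
  have hs : 1 - ((v 0 * w 0 + v 1 * w 1) / ‖w‖) ^ 2 =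
      (ε * (v 0 * w 1 - v 1 * w 0) / ‖w‖) ^ 2 := by
    rw [div_pow, div_pow, eq_div_iff (by positivity), sub_mul, div_mul_cancel₀ _ (by positivity),
      hw2]
    linear_combination (-(w 0 ^ 2 + w 1 ^ 2)) * hv2 - (v 0 * w 1 - v 1 * w 0) ^ 2 * hε
  rw [hs, Real.sqrt_sq (by positivity), div_div_div_cancel_right₀ hw.ne']

namespace IsConvexBilliardTable

variable {r : ℕ} {Ω : Set Plane} {L : ℝ} {γ : ℝ → Plane}

open scoped Topology in
/-- Third order expansion of the angle between the tangent and a short chord. -/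
theorem tendsto_chord_angle (h : IsConvexBilliardTable r Ω L γ) (hr : 4 ≤ r) {ι : Type*}
    {l : Filter ι} {S H : ι → ℝ} {s₀ : ℝ} (hS : Tendsto S l (𝓝 s₀)) (hH : Tendsto H l (𝓝 0))
    (hpos : ∀ᶠ i in l, 0 < H i) {κ κ' κ'' : ℝ → ℝ} (hκ : ∀ s, κ s = ‖deriv (deriv γ) s‖)
    (hκ' : ∀ s, HasDerivAt κ (κ' s) s) (hκ'' : ∀ s, HasDerivAt κ' (κ'' s) s) :
    Tendsto (fun i => (InnerProductGeometry.angle (deriv γ (S i)) (γ (S i + H i) - γ (S i)) -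
      κ (S i) * H i / 2 - κ' (S i) * H i ^ 2 / 6) / H i ^ 3) l (𝓝 (κ'' s₀ / 24)) := by
  have hr2 : 2 ≤ r := by omega
  obtain ⟨ε, hε, hfr⟩ := h.exists_frenet hr2
  simp only [← hκ] at hfr
  set a : ℝ → ℝ := fun s => deriv γ s 0 with ha
  set b : ℝ → ℝ := fun s => deriv γ s 1 with hb
  have hab : ∀ s, a s ^ 2 + b s ^ 2 = 1 := h.tangent_sq
  have hx : ∀ s, HasDerivAt (fun s => γ s 0) (a s) s := fun s => (h.hasDerivAt hr2 s).coord 0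
  have hy : ∀ s, HasDerivAt (fun s => γ s 1) (b s) s := fun s => (h.hasDerivAt hr2 s).coord 1
  have ha' : ∀ s, HasDerivAt a (-(ε * κ s * b s)) s := fun s => by
    rw [← (hfr s).1]; exact (h.hasDerivAt_deriv hr2 s).coord 0
  have hb' : ∀ s, HasDerivAt b (ε * κ s * a s) s := fun s => by
    rw [← (hfr s).2]; exact (h.hasDerivAt_deriv hr2 s).coord 1
  have ha'' : ∀ s, HasDerivAt (fun s => -(ε * κ s * b s)) (-(ε * κ' s * b s) - κ s ^ 2 * a s) s :=
    fun s => by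
    refine ((((hκ' s).const_mul ε).fun_mul (hb' s)).fun_neg).congr_deriv ?_
    linear_combination (-κ s ^ 2 * a s) * hε
  have hb'' : ∀ s, HasDerivAt (fun s => ε * κ s * a s) (ε * κ' s * a s - κ s ^ 2 * b s) s :=
    fun s => by
    refine (((hκ' s).const_mul ε).fun_mul (ha' s)).congr_deriv ?_
    linear_combination (-κ s ^ 2 * b s) * hε
  have ha''' : ∀ s, HasDerivAt (fun s => -(ε * κ' s * b s) - κ s ^ 2 * a s)
      (-(ε * κ'' s * b s) - 3 * κ s * κ' s * a s + ε * κ s ^ 3 * b s) s := fun s => by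
    refine ((((hκ'' s).const_mul ε).fun_mul (hb' s)).fun_neg.fun_sub
      (((hκ' s).fun_pow 2).fun_mul (ha' s))).congr_deriv ?_
    simp only [Nat.cast_ofNat, Nat.add_one_sub_one, pow_one]
    linear_combination (-κ s * κ' s * a s) * hε
  have hb''' : ∀ s, HasDerivAt (fun s => ε * κ' s * a s - κ s ^ 2 * b s)
      (ε * κ'' s * a s - 3 * κ s * κ' s * b s - ε * κ s ^ 3 * a s) s := fun s => by
    refine ((((hκ'' s).const_mul ε).fun_mul (ha' s)).fun_sub
      (((hκ' s).fun_pow 2).fun_mul (hb' s))).congr_deriv ?_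
    simp only [Nat.cast_ofNat, Nat.add_one_sub_one, pow_one]
    linear_combination (-κ s * κ' s * b s) * hε
  have hC : ∀ i : Fin 2, ContDiff ℝ r (fun s => γ s i) := fun i =>
    (EuclideanSpace.proj (𝕜 := ℝ) i : Plane →L[ℝ] ℝ).contDiff.comp h.contDiff
  have hC4 : ∀ i : Fin 2, ContDiff ℝ ((3 : ℕ) + 1) (fun s => γ s i) := fun i =>
    (hC i).of_le (by exact_mod_cast hr)
  have hC3 : ∀ i : Fin 2, ContDiff ℝ ((2 : ℕ) + 1) (fun s => γ s i) := fun i =>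
    (hC i).of_le (by exact_mod_cast (by omega : 2 + 1 ≤ r))
  -- The coordinate along the tangent is needed with remainder of order `H³`, the one across with
  -- remainder of order `H⁴`.
  have tx3 := tendsto_taylor_remainder (hC3 0) hS hH hpos
  have ty3 := tendsto_taylor_remainder (hC3 1) hS hH hpos
  have tx4 := tendsto_taylor_remainder (hC4 0) hS hH hpos
  have ty4 := tendsto_taylor_remainder (hC4 1) hS hH hpos
  simp only [Finset.sum_range_succ, Finset.sum_range_zero, iteratedDeriv_succ, iteratedDeriv_zero,
    funext fun s => (hx s).deriv, funext fun s => (hy s).deriv, funext fun s => (ha' s).deriv,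
    funext fun s => (hb' s).deriv, funext fun s => (ha'' s).deriv, funext fun s => (hb'' s).deriv,
    funext fun s => (ha''' s).deriv, funext fun s => (hb''' s).deriv] at tx3 ty3 tx4 ty4
  norm_num [Nat.factorial] at tx3 ty3 tx4 ty4
  have la : Tendsto (fun i => a (S i)) l (𝓝 (a s₀)) := (ha' s₀).continuousAt.tendsto.comp hS
  have lb : Tendsto (fun i => b (S i)) l (𝓝 (b s₀)) := (hb' s₀).continuousAt.tendsto.comp hS
  have lκ : Tendsto (fun i => κ (S i)) l (𝓝 (κ s₀)) := (hκ' s₀).continuousAt.tendsto.comp hS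
  have lκ' : Tendsto (fun i => κ' (S i)) l (𝓝 (κ' s₀)) := (hκ'' s₀).continuousAt.tendsto.comp hS
  have lU := (la.mul tx3).add (lb.mul ty3)
  have lV := ((la.mul ty4).sub (lb.mul tx4)).const_mul ε
  have hκpos : 0 < κ s₀ := by rw [hκ]; exact norm_pos_iff.2 (h.curvature_ne s₀)
  rw [show a s₀ * ((-(ε * κ' s₀ * b s₀) - κ s₀ ^ 2 * a s₀) / 6) +
      b s₀ * ((ε * κ' s₀ * a s₀ - κ s₀ ^ 2 * b s₀) / 6) = -κ s₀ ^ 2 / 6 by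
    linear_combination (-κ s₀ ^ 2 / 6) * hab s₀] at lU
  rw [show ε * (a s₀ * ((ε * κ'' s₀ * a s₀ - 3 * κ s₀ * κ' s₀ * b s₀ - ε * κ s₀ ^ 3 * a s₀) / 24) -
      b s₀ * ((-(ε * κ'' s₀ * b s₀) - 3 * κ s₀ * κ' s₀ * a s₀ + ε * κ s₀ ^ 3 * b s₀) / 24)) =
      (κ'' s₀ - κ s₀ ^ 3) / 24 by
    linear_combination ((κ'' s₀ - κ s₀ ^ 3) / 24) * hab s₀ +
      ((κ'' s₀ - κ s₀ ^ 3) * (a s₀ ^ 2 + b s₀ ^ 2) / 24) * hε] at lV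
  obtain ⟨U, hU, lU⟩ : ∃ U : ι → ℝ, (∀ i, U i =
      a (S i) * ((γ (S i + H i) 0 - (γ (S i) 0 + H i * a (S i) +
        -(1 / 2 * H i ^ 2 * (ε * κ (S i) * b (S i))))) / H i ^ 3) +
      b (S i) * ((γ (S i + H i) 1 - (γ (S i) 1 + H i * b (S i) +
        1 / 2 * H i ^ 2 * (ε * κ (S i) * a (S i)))) / H i ^ 3)) ∧
      Tendsto U l (𝓝 (-κ s₀ ^ 2 / 6)) := ⟨_, fun _ => rfl, lU⟩
  obtain ⟨V, hV, lV⟩ : ∃ V : ι → ℝ, (∀ i, V i =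
      ε * (a (S i) * ((γ (S i + H i) 1 - (γ (S i) 1 + H i * b (S i) +
        1 / 2 * H i ^ 2 * (ε * κ (S i) * a (S i)) +
        1 / 6 * H i ^ 3 * (ε * κ' (S i) * a (S i) - κ (S i) ^ 2 * b (S i)))) / H i ^ 4) -
      b (S i) * ((γ (S i + H i) 0 - (γ (S i) 0 + H i * a (S i) +
        -(1 / 2 * H i ^ 2 * (ε * κ (S i) * b (S i))) +
        1 / 6 * H i ^ 3 * (-(ε * κ' (S i) * b (S i)) - κ (S i) ^ 2 * a (S i)))) / H i ^ 4))) ∧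
      Tendsto V l (𝓝 ((κ'' s₀ - κ s₀ ^ 3) / 24)) := ⟨_, fun _ => rfl, lV⟩
  have hmain := tendsto_arctan_quotient hκpos hH hpos lU lV lκ lκ'
  -- The cubes of the curvature cancel.
  rw [show (κ'' s₀ - κ s₀ ^ 3) / 24 + κ s₀ ^ 3 / 24 = κ'' s₀ / 24 by ring] at hmain
  have hden : ∀ᶠ i in l, 0 < 1 + H i ^ 2 * U i := by
    have : Tendsto (fun i => 1 + H i ^ 2 * U i) l (𝓝 1) := by
      simpa using ((hH.pow 2).mul lU).const_add 1
    exact this.eventually (lt_mem_nhds one_pos)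
  have hnum : ∀ᶠ i in l, 0 < κ (S i) / 2 + H i * κ' (S i) / 6 + H i ^ 2 * V i := by
    have : Tendsto (fun i => κ (S i) / 2 + H i * κ' (S i) / 6 + H i ^ 2 * V i) l
        (𝓝 (κ s₀ / 2)) := by
      simpa using ((lκ.div_const 2).add ((hH.mul lκ').div_const 6)).add ((hH.pow 2).mul lV)
    exact this.eventually (lt_mem_nhds (half_pos hκpos))
  refine hmain.congr' ?_
  filter_upwards [hpos, hden, hnum] with i hi hdi hni
  have hu : a (S i) * (γ (S i + H i) - γ (S i)) 0 + b (S i) * (γ (S i + H i) - γ (S i)) 1 =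
      H i * (1 + H i ^ 2 * U i) := by
    rw [hU, PiLp.sub_apply, PiLp.sub_apply]
    field_simp
    linear_combination (2 * H i) * hab (S i)
  have hv : ε * (a (S i) * (γ (S i + H i) - γ (S i)) 1 - b (S i) * (γ (S i + H i) - γ (S i)) 0) =
      H i ^ 2 * (κ (S i) / 2 + H i * κ' (S i) / 6 + H i ^ 2 * V i) := by
    rw [hV, PiLp.sub_apply, PiLp.sub_apply]
    field_simp
    linear_combination (6 * H i ^ 2 * κ (S i) + 2 * H i ^ 3 * κ' (S i)) *
      (hab (S i) + (a (S i) ^ 2 + b (S i) ^ 2) * hε)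
  rw [Plane.angle_eq_arctan (h.unit_speed (S i)) hε (by rw [hu]; positivity)
    (by rw [hv]; positivity), hu, hv]
  congr 4
  field_simp

end IsConvexBilliardTable

/-! ### Lazutkin coordinates in terms of the cube root of the curvature -/

/-- The cube root of the curvature of a unit speed curve. -/
noncomputable def cbrtCurvature (γ : ℝ → Plane) (s : ℝ) : ℝ := ‖deriv (deriv γ) s‖ ^ (1 / 3 : ℝ)

namespace IsConvexBilliardTable

variable {r : ℕ} {Ω : Set Plane} {L : ℝ} {γ : ℝ → Plane}

theorem cbrtCurvature_pos (h : IsConvexBilliardTable r Ω L γ) (s : ℝ) : 0 < cbrtCurvature γ s :=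
  Real.rpow_pos_of_pos (norm_pos_iff.2 (h.curvature_ne s)) _

theorem cbrtCurvature_pow_three (γ : ℝ → Plane) (s : ℝ) :
    cbrtCurvature γ s ^ 3 = ‖deriv (deriv γ) s‖ := by
  rw [cbrtCurvature, ← Real.rpow_natCast, ← Real.rpow_mul (norm_nonneg _)]
  norm_num

theorem contDiff_cbrtCurvature (h : IsConvexBilliardTable r Ω L γ) {n : ℕ} (hn : n + 2 ≤ r) :
    ContDiff ℝ n (cbrtCurvature γ) :=
  (h.contDiff_curvature hn).rpow_const_of_ne fun s => norm_ne_zero_iff.2 (h.curvature_ne s)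

theorem curvRadius_eq (γ : ℝ → Plane) (s : ℝ) : curvRadius γ s = (cbrtCurvature γ s ^ 3)⁻¹ := by
  rw [curvRadius, cbrtCurvature_pow_three]

theorem curvRadius_rpow_third (γ : ℝ → Plane) (s : ℝ) :
    curvRadius γ s ^ (1 / 3 : ℝ) = (cbrtCurvature γ s)⁻¹ :=
  Real.inv_rpow (norm_nonneg _) _

theorem curvRadius_rpow_neg_two_thirds (γ : ℝ → Plane) (s : ℝ) :
    curvRadius γ s ^ (-(2 / 3) : ℝ) = cbrtCurvature γ s ^ 2 := by
  rw [cbrtCurvature, curvRadius, ← Real.rpow_natCast, ← Real.rpow_mul (norm_nonneg _),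
    Real.rpow_neg (by positivity), Real.inv_rpow (norm_nonneg _), inv_inv]
  norm_num

theorem continuous_cbrtCurvature (h : IsConvexBilliardTable r Ω L γ) (hr : 2 ≤ r) :
    Continuous (cbrtCurvature γ) :=
  (h.contDiff_cbrtCurvature (n := 0) hr).continuous

theorem lazutkinConst_pos (h : IsConvexBilliardTable r Ω L γ) (hr : 2 ≤ r) :
    0 < lazutkinConst L γ := by
  unfold lazutkinConst
  simp only [curvRadius_rpow_neg_two_thirds]
  exact inv_pos.2 (intervalIntegral.intervalIntegral_pos_of_pos
    (((h.continuous_cbrtCurvature hr).pow 2).intervalIntegrable _ _)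
    (fun s => pow_pos (h.cbrtCurvature_pos s) 2) h.length_pos)

theorem hasDerivAt_lazutkinParam (h : IsConvexBilliardTable r Ω L γ) (hr : 2 ≤ r) (s : ℝ) :
    HasDerivAt (lazutkinParam L γ) (lazutkinConst L γ * cbrtCurvature γ s ^ 2) s := by
  unfold lazutkinParam
  simp only [curvRadius_rpow_neg_two_thirds]
  have hc := (h.continuous_cbrtCurvature hr).pow 2
  exact (intervalIntegral.integral_hasDerivAt_right (hc.intervalIntegrable 0 s)
    hc.stronglyMeasurable.stronglyMeasurableAtFilter hc.continuousAt).const_mul _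

theorem contDiff_lazutkinParam (h : IsConvexBilliardTable r Ω L γ) {n : ℕ} (hn : n + 2 ≤ r) :
    ContDiff ℝ (n + 1) (lazutkinParam L γ) := by
  have hd := h.hasDerivAt_lazutkinParam (by omega)
  refine contDiff_succ_iff_deriv.2 ⟨fun s => (hd s).differentiableAt, by simp, ?_⟩
  rw [funext fun s => (hd s).deriv]
  exact contDiff_const.mul ((h.contDiff_cbrtCurvature hn).pow 2)

theorem arclengthOf_lazutkinParam (h : IsConvexBilliardTable r Ω L γ) (hr : 2 ≤ r) (s : ℝ) :
    arclengthOf L γ (lazutkinParam L γ s) = s :=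
  Function.leftInverse_invFun (lazutkinParam_bijective hr h).injective s

theorem continuous_arclengthOf (h : IsConvexBilliardTable r Ω L γ) (hr : 2 ≤ r) :
    Continuous (arclengthOf L γ) := by
  have hm : StrictMono (lazutkinParam L γ) := strictMono_of_deriv_pos fun s => by
    rw [(h.hasDerivAt_lazutkinParam hr s).deriv]
    exact mul_pos (h.lazutkinConst_pos hr) (pow_pos (h.cbrtCurvature_pos s) 2)
  have he : arclengthOf L γ =
      (hm.orderIsoOfSurjective _ (lazutkinParam_bijective hr h).surjective).symm := by
    funext x
    obtain ⟨s, rfl⟩ := (lazutkinParam_bijective hr h).surjective x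
    rw [h.arclengthOf_lazutkinParam hr, StrictMono.orderIsoOfSurjective_symm_apply_self]
  rw [he]
  exact OrderIso.continuous _

theorem lazutkinDensity_lazutkinParam (h : IsConvexBilliardTable r Ω L γ) (hr : 2 ≤ r) (s : ℝ) :
    lazutkinDensity L γ (lazutkinParam L γ s) =
      cbrtCurvature γ s / (2 * lazutkinConst L γ) := by
  rw [lazutkinDensity, h.arclengthOf_lazutkinParam hr, curvRadius_rpow_third]
  have := (h.lazutkinConst_pos hr).ne'
  have := (h.cbrtCurvature_pos s).ne'
  field_simp

open scoped Topology in
/-- The deviation of the billiard map from a rotation in Lazutkin coordinates. -/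
theorem tendsto_lazutkin_defect (h : IsConvexBilliardTable r Ω L γ) (hr : 4 ≤ r) {ι : Type*}
    {l : Filter ι} {S H : ι → ℝ} {s₀ : ℝ} (hS : Tendsto S l (𝓝 s₀)) (hH : Tendsto H l (𝓝 0))
    (hpos : ∀ᶠ i in l, 0 < H i) {c' c'' : ℝ → ℝ} (hc' : ∀ s, HasDerivAt (cbrtCurvature γ) (c' s) s)
    (hc'' : ∀ s, HasDerivAt c' (c'' s) s) :
    Tendsto (fun i => (lazutkinParam L γ (S i + H i) - lazutkinParam L γ (S i) -
        InnerProductGeometry.angle (deriv γ (S i)) (γ (S i + H i) - γ (S i)) /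
          lazutkinDensity L γ (lazutkinParam L γ (S i))) / H i ^ 3) l
      (𝓝 (lazutkinConst L γ * (-c' s₀ ^ 2 / 6 + cbrtCurvature γ s₀ * c'' s₀ / 12))) := by
  have hr2 : 2 ≤ r := by omega
  set c := cbrtCurvature γ with hc
  set C := lazutkinConst L γ with hC
  have hC0 : 0 < C := h.lazutkinConst_pos hr2
  have hc0 : ∀ s, 0 < c s := h.cbrtCurvature_pos
  have hX : ∀ s, HasDerivAt (lazutkinParam L γ) (C * c s ^ 2) s := h.hasDerivAt_lazutkinParam hr2
  have hX2 : ∀ s, HasDerivAt (fun s => C * c s ^ 2) (C * (2 * c s * c' s)) s := fun s => by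
    simpa using ((hc' s).fun_pow 2).const_mul C
  have hX3 : ∀ s, HasDerivAt (fun s => C * (2 * c s * c' s))
      (C * (2 * c' s ^ 2 + 2 * c s * c'' s)) s := fun s =>
    ((((hc' s).const_mul 2).fun_mul (hc'' s)).const_mul C).congr_deriv (by ring)
  have hκ' : ∀ s, HasDerivAt (fun s => c s ^ 3) (3 * c s ^ 2 * c' s) s := fun s => by
    simpa using (hc' s).fun_pow 3
  have hκ'' : ∀ s, HasDerivAt (fun s => 3 * c s ^ 2 * c' s)
      (6 * c s * c' s ^ 2 + 3 * c s ^ 2 * c'' s) s := fun s =>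
    ((((hc' s).fun_pow 2).const_mul 3).fun_mul (hc'' s)).congr_deriv (by norm_num; ring)
  have t1 := tendsto_taylor_remainder (n := 2) (h.contDiff_lazutkinParam (n := 2) hr) hS hH hpos
  simp only [Finset.sum_range_succ, Finset.sum_range_zero, iteratedDeriv_succ, iteratedDeriv_zero,
    funext fun s => (hX s).deriv, funext fun s => (hX2 s).deriv,
    funext fun s => (hX3 s).deriv] at t1
  norm_num [Nat.factorial] at t1
  have t2 := h.tendsto_chord_angle hr hS hH hpos (κ := fun s => c s ^ 3) (fun s => cbrtCurvature_pow_three γ s) hκ' hκ''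
  have lc : Tendsto (fun i => c (S i)) l (𝓝 (c s₀)) := (hc' s₀).continuousAt.tendsto.comp hS
  -- Division by the density `c / (2C)` multiplies the angle by `2C / c`. With `κ = c³` its first
  -- two terms become `C c² H + C c c' H²`, exactly those of the Lazutkin increment, so only the
  -- cubic terms are left.
  have t3 := t1.sub (((lc.inv₀ (hc0 s₀).ne').const_mul (2 * C)).mul t2)
  have e : C * (2 * c' s₀ ^ 2 + 2 * c s₀ * c'' s₀) / 6 -
      2 * C * (c s₀)⁻¹ * ((6 * c s₀ * c' s₀ ^ 2 + 3 * c s₀ ^ 2 * c'' s₀) / 24) =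
      C * (-c' s₀ ^ 2 / 6 + c s₀ * c'' s₀ / 12) := by
    have := (hc0 s₀).ne'
    field_simp
    ring
  rw [e] at t3
  refine t3.congr' ?_
  filter_upwards [hpos] with i hi
  rw [h.lazutkinDensity_lazutkinParam hr2]
  have := (hc0 (S i)).ne'
  simp only [← hc, ← hC]
  field_simp
  ring

end IsConvexBilliardTable

/-! ### Matching the expansion with the geometry -/

namespace AreLazutkinCoefficients

variable {r : ℕ} {Ω : Set Plane} {L : ℝ} {γ : ℝ → Plane} {α β : ℝ → ℝ}

/-- Near a given point, two consecutive collisions of some orbit of rotation number `1/q`. -/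
theorem exists_collisions_near (hαβ : AreLazutkinCoefficients r L γ α β)
    (h : IsConvexBilliardTable r Ω L γ) (hr : 2 ≤ r) (x : ℝ) :
    ∃ K : ℝ, ∀ q : ℕ, 2 ≤ q → ∃ t S H a a' b : ℝ, 0 < H ∧ |t - x| ≤ (q : ℝ)⁻¹ ∧
      |a| ≤ K ∧ |a'| ≤ K ∧ |b| ≤ K ∧
      lazutkinParam L γ S = t + α t / (q : ℝ) ^ 2 + a / (q : ℝ) ^ 4 ∧
      lazutkinParam L γ (S + H) =
        t + (q : ℝ)⁻¹ + α (t + (q : ℝ)⁻¹) / (q : ℝ) ^ 2 + a' / (q : ℝ) ^ 4 ∧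
      InnerProductGeometry.angle (deriv γ S) (γ (S + H) - γ S) =
        lazutkinDensity L γ (lazutkinParam L γ S) / q *
          (1 + β t / (q : ℝ) ^ 2 + b / (q : ℝ) ^ 4) := by
  obtain ⟨K, hK⟩ := hαβ.expansion
  refine ⟨K, fun q hq => ?_⟩
  obtain ⟨s, φ, hs⟩ := h.exists_periodicOrbit hr hq
  obtain ⟨θ, hθ⟩ := hK q hq s φ hs
  have hq0 : (0 : ℝ) < q := by exact_mod_cast (by omega : 0 < q)
  -- The collision whose phase is the last one not beyond `x`, hence within `1/q` of it.
  set k : ℤ := ⌊(x - θ) * q⌋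
  obtain ⟨a, b, ha, hb, hx, hφ⟩ := hθ k
  obtain ⟨a', b', ha', -, hx', -⟩ := hθ (k + 1)
  refine ⟨θ + k / q, s k, s (k + 1) - s k, a, a', b, sub_pos.2 (hs.advance k).1, ?_, ha, ha', hb,
    hx, ?_, ?_⟩
  · have h1 := Int.floor_le ((x - θ) * q)
    have h2 := Int.lt_floor_add_one ((x - θ) * q)
    have e : θ + k / q - x = (k - (x - θ) * q) / q := by field_simp; ring
    rw [e, abs_div, abs_of_pos hq0, div_le_iff₀ hq0, inv_mul_cancel₀ hq0.ne', abs_le]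
    simp only [k]
    constructor <;> linarith
  · have e : θ + ((k + 1 : ℤ) : ℝ) / q = θ + k / q + (q : ℝ)⁻¹ := by push_cast; field_simp; ring
    rw [e] at hx'
    rw [add_sub_cancel]
    exact hx'
  · rw [add_sub_cancel, hs.outgoing k, hφ]

open scoped Topology in
-- Both evaluations of the defect, multiplied by `q³`, converge along collisions tending to `x`;
-- uniqueness of limits equates them.
theorem deriv_sub_eq (hαβ : AreLazutkinCoefficients r L γ α β)
    (h : IsConvexBilliardTable r Ω L γ) (hr : 5 ≤ r) {c' c'' : ℝ → ℝ}
    (hc' : ∀ s, HasDerivAt (cbrtCurvature γ) (c' s) s)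
    (hc'' : ∀ s, HasDerivAt c' (c'' s) s) (x : ℝ) :
    deriv α x - β x = (-c' (arclengthOf L γ x) ^ 2 / 6 +
      cbrtCurvature γ (arclengthOf L γ x) * c'' (arclengthOf L γ x) / 12) /
        (lazutkinConst L γ ^ 2 * cbrtCurvature γ (arclengthOf L γ x) ^ 6) := by
  have hr2 : 2 ≤ r := by omega
  set X := lazutkinParam L γ with hX
  set s₀ := arclengthOf L γ x with hs₀
  set C := lazutkinConst L γ with hC
  set c := cbrtCurvature γ s₀ with hc
  have hC0 : 0 < C := h.lazutkinConst_pos hr2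
  have hc0 : 0 < c := h.cbrtCurvature_pos s₀
  obtain ⟨K, hK⟩ := hαβ.exists_collisions_near h hr2 x
  have hK' := fun n : ℕ => hK (n + 2) (by omega)
  choose t S H a a' b hpos ht ha ha' hb hxS hxH hang using hK'
  set N : ℕ → ℝ := fun n => ((n + 2 : ℕ) : ℝ) with hN
  replace hxS : ∀ n, X (S n) = t n + α (t n) / N n ^ 2 + a n / N n ^ 4 := hxS
  replace hxH : ∀ n, X (S n + H n) =
    t n + (N n)⁻¹ + α (t n + (N n)⁻¹) / N n ^ 2 + a' n / N n ^ 4 := hxH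
  replace hang : ∀ n, InnerProductGeometry.angle (deriv γ (S n)) (γ (S n + H n) - γ (S n)) =
    lazutkinDensity L γ (X (S n)) / N n * (1 + β (t n) / N n ^ 2 + b n / N n ^ 4) := hang
  have hN0 : ∀ n, 0 < N n := fun n => by simp only [hN]; positivity
  have lN : Tendsto (fun n => (N n)⁻¹) atTop (𝓝 0) :=
    tendsto_inv_atTop_zero.comp (tendsto_natCast_atTop_atTop.comp (tendsto_add_atTop_nat 2))
  have lbdd : ∀ u : ℕ → ℝ, (∀ n, |u n| ≤ K) → Tendsto (fun n => u n * (N n)⁻¹) atTop (𝓝 0) :=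
    fun u hu => by
    have h1 : Tendsto (fun n => K * (N n)⁻¹) atTop (𝓝 0) := by simpa using lN.const_mul K
    refine squeeze_zero_norm (fun n => ?_) h1
    rw [Real.norm_eq_abs, abs_mul, abs_of_pos (inv_pos.2 (hN0 n))]
    exact mul_le_mul_of_nonneg_right (hu n) (inv_pos.2 (hN0 n)).le
  have la := lbdd a ha
  have la' := lbdd a' ha'
  have lb := lbdd b hb
  have lt : Tendsto t atTop (𝓝 x) := by
    have : Tendsto (fun n => t n - x) atTop (𝓝 0) := squeeze_zero_norm ht lN
    simpa using this.add_const x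
  have lt' : Tendsto (fun n => t n + (N n)⁻¹) atTop (𝓝 x) := by simpa using lt.add lN
  have hα1 : ContDiff ℝ 1 α := hαβ.contDiff_α.of_le (by exact_mod_cast (by omega : 1 ≤ r - 4))
  have hαc := hα1.continuous.tendsto x
  have lα := hαc.comp lt
  have lα' := hαc.comp lt'
  have lβ := (hαβ.contDiff_β.continuous.tendsto x).comp lt
  have lXS : Tendsto (fun n => X (S n)) atTop (𝓝 x) := by
    have := (lt.add (lα.mul (lN.pow 2))).add (la.mul (lN.pow 3))
    simp only [ne_eq, OfNat.ofNat_ne_zero, not_false_eq_true, zero_pow, mul_zero, add_zero] at this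
    refine this.congr fun n => ?_
    rw [hxS]
    have := (hN0 n).ne'
    simp only [Function.comp_apply]
    field_simp
  have lXH : Tendsto (fun n => X (S n + H n)) atTop (𝓝 x) := by
    have := (lt'.add (lα'.mul (lN.pow 2))).add (la'.mul (lN.pow 3))
    simp only [ne_eq, OfNat.ofNat_ne_zero, not_false_eq_true, zero_pow, mul_zero, add_zero] at this
    refine this.congr fun n => ?_
    rw [hxH]
    have := (hN0 n).ne'
    simp only [Function.comp_apply]
    field_simp
  have hinv := (h.continuous_arclengthOf hr2).tendsto x
  have lS : Tendsto S atTop (𝓝 s₀) :=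
    (hinv.comp lXS).congr fun n => h.arclengthOf_lazutkinParam hr2 _
  have lSH : Tendsto (fun n => S n + H n) atTop (𝓝 s₀) :=
    (hinv.comp lXH).congr fun n => h.arclengthOf_lazutkinParam hr2 _
  have lH : Tendsto H atTop (𝓝 0) := by simpa using lSH.sub lS
  have hpos' : ∀ᶠ n in atTop, 0 < H n := Eventually.of_forall hpos
  have hdefect := h.tendsto_lazutkin_defect (by omega) lS lH hpos' hc' hc''
  -- the chords have length asymptotic to `1 / (C c² q)`
  have lDH : Tendsto (fun n => (X (S n + H n) - X (S n)) / H n) atTop (𝓝 (C * c ^ 2)) := by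
    have := tendsto_taylor_remainder (n := 0) (f := X)
      ((h.contDiff_lazutkinParam (n := 0) hr2).of_le (by simp)) lS lH hpos'
    have hd : deriv X s₀ = C * c ^ 2 := (h.hasDerivAt_lazutkinParam hr2 s₀).deriv
    simpa [hd] using this
  have lND : Tendsto (fun n => N n * (X (S n + H n) - X (S n))) atTop (𝓝 1) := by
    have := ((((lα'.sub lα).mul lN).add ((la'.sub la).mul (lN.pow 2)))).const_add 1
    simp only [ne_eq, OfNat.ofNat_ne_zero, not_false_eq_true, zero_pow, mul_zero, add_zero] at this
    refine this.congr fun n => ?_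
    rw [hxH, hxS]
    have := (hN0 n).ne'
    simp only [Function.comp_apply]
    field_simp
    ring
  have lNH : Tendsto (fun n => N n * H n) atTop (𝓝 (1 / (C * c ^ 2))) := by
    refine (lND.div lDH (by positivity)).congr' ?_
    have hne := lND.eventually_ne one_ne_zero
    filter_upwards [hne] with n hn
    have := (hpos n).ne'
    have h2 : X (S n + H n) - X (S n) ≠ 0 := right_ne_zero_of_mul hn
    simp only [Pi.div_apply]
    field_simp
  have lquot : Tendsto (fun n => N n * (α (t n + (N n)⁻¹) - α (t n))) atTop (𝓝 (deriv α x)) := by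
    have := tendsto_taylor_remainder (n := 0) (f := α) (by simpa using hα1) lt lN
      (Eventually.of_forall fun n => inv_pos.2 (hN0 n))
    simp only [zero_add, Finset.range_one, Finset.sum_singleton, iteratedDeriv_zero,
      iteratedDeriv_one, pow_one, pow_zero, Nat.factorial] at this
    simpa [mul_comm] using this
  have hlhs : Tendsto (fun n => N n ^ 3 * (X (S n + H n) - X (S n) -
      InnerProductGeometry.angle (deriv γ (S n)) (γ (S n + H n) - γ (S n)) /
        lazutkinDensity L γ (X (S n)))) atTop (𝓝 (deriv α x - β x)) := by
    have := ((lquot.add (la'.sub la)).sub lβ).sub (lb.mul lN)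
    simp only [mul_zero, add_zero, sub_zero] at this
    refine this.congr fun n => ?_
    have hμ : lazutkinDensity L γ (X (S n)) ≠ 0 := by
      rw [h.lazutkinDensity_lazutkinParam hr2]
      exact (div_pos (h.cbrtCurvature_pos _) (by positivity)).ne'
    have hN' := (hN0 n).ne'
    rw [hang]
    generalize lazutkinDensity L γ (X (S n)) = μ at hμ
    rw [hxH, hxS]
    simp only [Function.comp_apply]
    field_simp
    ring
  -- `N³ · defect = (defect / H³) (N H)³`, and `N H → 1 / (C c²)`.
  have hrhs := hdefect.mul (lNH.pow 3)
  have heq := tendsto_nhds_unique hlhs (hrhs.congr fun n => by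
    have := (hpos n).ne'
    rw [mul_pow, div_mul_eq_mul_div, div_eq_iff (by positivity)]
    ring)
  rw [heq]
  simp only [← hC, ← hc]
  field_simp

end AreLazutkinCoefficients

/-- Substituting `ρ = c⁻³`, `ρ' = -3 c' / c⁴` and `ρ'' = -3 c'' / c⁴ + 12 c'² / c⁵` turns the `ρ`
terms into `(c c''/12 - c'²/6) / (C² c⁶)`, the value in `deriv_sub_eq`. -/
theorem lemmaB1 (r : ℕ) (hr : 8 ≤ r) (Ω : Set Plane) (L : ℝ) (γ : ℝ → Plane)
    (hΩ : IsConvexBilliardTable r Ω L γ) (α β : ℝ → ℝ)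
    (hαβ : AreLazutkinCoefficients r L γ α β) (x : ℝ) :
    HasDerivAt α
      (β x
        + -(curvRadius γ (arclengthOf L γ x) ^ (1 / 3 : ℝ)
              * deriv (deriv (curvRadius γ)) (arclengthOf L γ x))
            / (36 * lazutkinConst L γ ^ 2)
        + curvRadius γ (arclengthOf L γ x) ^ (-(2 / 3) : ℝ)
              * deriv (curvRadius γ) (arclengthOf L γ x) ^ 2
            / (54 * lazutkinConst L γ ^ 2)) x := by
  have hr2 : 2 ≤ r := by omega
  have hc2 : ContDiff ℝ ((1 : ℕ) + 1) (cbrtCurvature γ) := by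
    exact_mod_cast hΩ.contDiff_cbrtCurvature (n := 2) (by omega)
  have hc' : ∀ s, HasDerivAt (cbrtCurvature γ) (deriv (cbrtCurvature γ) s) s := fun s =>
    (hc2.differentiable (by norm_num) s).hasDerivAt
  have hc'' : ∀ s, HasDerivAt (deriv (cbrtCurvature γ)) (deriv (deriv (cbrtCurvature γ)) s) s :=
    fun s => ((contDiff_succ_iff_deriv.1 hc2).2.2.differentiable (by norm_num) s).hasDerivAt
  have hmain := hαβ.deriv_sub_eq hΩ (by omega) hc' hc'' x
  have hα : HasDerivAt α (deriv α x) x :=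
    (hαβ.contDiff_α.differentiable (by exact_mod_cast (by omega : r - 4 ≠ 0)) x).hasDerivAt
  set c := cbrtCurvature γ with hc
  have hc0 : ∀ s, c s ≠ 0 := fun s => (hΩ.cbrtCurvature_pos s).ne'
  have hC0 := (hΩ.lazutkinConst_pos hr2).ne'
  have hρ' : ∀ s, HasDerivAt (curvRadius γ) (-3 * deriv c s / c s ^ 4) s := fun s => by
    rw [show curvRadius γ = fun s => (c s ^ 3)⁻¹ from
      funext (IsConvexBilliardTable.curvRadius_eq γ)]
    refine ((hc' s).fun_pow 3).fun_inv (pow_ne_zero _ (hc0 s)) |>.congr_deriv ?_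
    have := hc0 s
    norm_num
    field_simp
  have hρ'' : ∀ s, HasDerivAt (fun s => -3 * deriv c s / c s ^ 4)
      (-3 * deriv (deriv c) s / c s ^ 4 + 12 * deriv c s ^ 2 / c s ^ 5) s := fun s => by
    refine ((hc'' s).const_mul (-3)).fun_div ((hc' s).fun_pow 4) (pow_ne_zero _ (hc0 s))
      |>.congr_deriv ?_
    have := hc0 s
    norm_num
    field_simp
    ring
  refine hα.congr_deriv ?_
  rw [funext fun s => (hρ' s).deriv, (hρ'' _).deriv, IsConvexBilliardTable.curvRadius_rpow_third,
    IsConvexBilliardTable.curvRadius_rpow_neg_two_thirds, ← hc, ← sub_add_cancel (deriv α x) (β x),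
    hmain]
  have := hc0 (arclengthOf L γ x)
  field_simp
  ring
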